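/- Let $T,D,a\in\mathbb{R}$ with $a^2+D^2\neq 0$ and consider the planar linear system $\dot x=Tx-y$, $\dot y=Dx-a$. For $y_0\ge 0$ let $\Phi(t;y_0)=(\Phi_1(t;y_0),\Phi_2(t;y_0))$ be its solution with $\Phi(0;y_0)=(0,y_0)$. If there is $\tau>0$ with $\Phi_1(\tau;y_0)=0$ and $\Phi_1(t;y_0)<0$ for all $t\in(0,\tau)$, then this $\tau$ is unique; in that case put $P(y_0)=\Phi_2(\tau;y_0)$. If no such $\tau$ exists for $y_0=0$, but for every $\varepsilon>0$ there is $u\in(0,\varepsilon)$ at which $P$ is defined in this way with $P(u)\in(-\varepsilon,0)$, put $P(0)=0$. The function $P$ is called the left Poincaré half-map; let $I\subset[0,+\infty)$ be the set on which it is defined, $\operatorname{int}(I)$ the interior of $I$ in $\mathbb{R}$, and $W(y)=Dy^2-aTy+a^2$. Then $P$ is twice differentiable on $\operatorname{int}(I)$, and for every $y_0\in\operatorname{int}(I)$ one has $P(y_0)\neq 0$, $W(y_0)\neq 0$, $$\frac{dP}{dy_0}(y_0)=\frac{y_0\,W(P(y_0))}{P(y_0)\,W(y_0)}\qquad\text{and}\qquad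 \frac{d^2P}{dy_0^2}(y_0)=-\frac{a^2\left(y_0^2-P(y_0)^2\right)W(P(y_0))}{P(y_0)^3\,W(y_0)^2}.$$ -/

import Mathlib

namespace PoincareHalfMap

/-- `(x, y)` is a (global) solution of the planar linear system in generalized Liénard form
`x' = T x - y`, `y' = D x - a`. -/
def IsSolution (T D a : ℝ) (x y : ℝ → ℝ) : Prop :=
  ∀ t : ℝ, HasDerivAt x (T * x t - y t) t ∧ HasDerivAt y (D * x t - a) t

/-- The orbit through `(0, y₀)` has a left flight time `τ > 0`: it lies in the open half-plane
`x < 0` for all `t ∈ (0, τ)` and is at the point `(0, y₁)` of the section `x = 0` at time `τ`. -/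
def FlowReturn (T D a y₀ y₁ : ℝ) : Prop :=
  ∃ x y : ℝ → ℝ, IsSolution T D a x y ∧ x 0 = 0 ∧ y 0 = y₀ ∧
    ∃ τ : ℝ, 0 < τ ∧ (∀ t : ℝ, 0 < t → t < τ → x t < 0) ∧ x τ = 0 ∧ y τ = y₁

/-- The graph of the left Poincaré half-map: for `y₀ ≥ 0`, the image of `y₀` is the point of first
return given by the flow; at the origin, when the flow gives no such point, the value `0` is
assigned by continuous extension, provided that there are points `y > 0` arbitrarily close to `0`
whose images are negative and arbitrarily close to `0`. -/
def LeftGraph (T D a y₀ y₁ : ℝ) : Prop :=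
  0 ≤ y₀ ∧
    (FlowReturn T D a y₀ y₁ ∨
      (y₀ = 0 ∧ y₁ = 0 ∧ (¬ ∃ z : ℝ, FlowReturn T D a 0 z) ∧
        ∀ ε : ℝ, 0 < ε → ∃ u v : ℝ, 0 < u ∧ u < ε ∧ -ε < v ∧ v < 0 ∧ FlowReturn T D a u v))

/-- The domain `I ⊆ [0, ∞)` of the left Poincaré half-map. -/
def leftDomain (T D a : ℝ) : Set ℝ :=
  {y₀ | ∃ y₁ : ℝ, LeftGraph T D a y₀ y₁}

open Classical in
/-- The left Poincaré half-map `P` (with the irrelevant value `0` outside its domain). -/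
noncomputable def leftMap (T D a : ℝ) (y₀ : ℝ) : ℝ :=
  if h : ∃ y₁ : ℝ, LeftGraph T D a y₀ y₁ then h.choose else 0

/-- The quadratic polynomial `W(y) = D y² - a T y + a²`. -/
def W (T D a y : ℝ) : ℝ :=
  D * y ^ 2 - a * T * y + a ^ 2

/-- Solutions are determined by their initial values. -/
theorem IsSolution.unique {T D a : ℝ} {x y x' y' : ℝ → ℝ} (h : IsSolution T D a x y)
    (h' : IsSolution T D a x' y') (hx : x 0 = x' 0) (hy : y 0 = y' 0) : x = x' ∧ y = y' := by
  let L : ℝ × ℝ →L[ℝ] ℝ × ℝ :=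
    (T • ContinuousLinearMap.fst ℝ ℝ ℝ - ContinuousLinearMap.snd ℝ ℝ ℝ).prod
      (D • ContinuousLinearMap.fst ℝ ℝ ℝ)
  have hL : ∀ p : ℝ × ℝ, L p = (T * p.1 - p.2, D * p.1) := fun p => by simp [L]
  have key : (fun t => (x t, y t)) = fun t => (x' t, y' t) := by
    refine ODE_solution_unique_univ (v := fun _ p => L p - (0, a)) (s := fun _ => Set.univ)
      (K := ‖L‖₊) (t₀ := 0) ?_ ?_ ?_ ?_
    · intro t
      have : LipschitzWith ‖L‖₊ (fun p => L p - ((0 : ℝ), a)) := by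
        refine LipschitzWith.of_dist_le_mul fun p q => ?_
        simpa [dist_sub_right] using L.lipschitz.dist_le_mul p q
      exact this.lipschitzOnWith
    · intro t
      refine ⟨?_, Set.mem_univ _⟩
      simpa [hL] using (h t).1.prodMk (h t).2
    · intro t
      refine ⟨?_, Set.mem_univ _⟩
      simpa [hL] using (h' t).1.prodMk (h' t).2
    · simp [hx, hy]
  exact ⟨funext fun t => congrArg Prod.fst (congrFun key t),
    funext fun t => congrArg Prod.snd (congrFun key t)⟩

theorem FlowReturn.unique {T D a y₀ y₁ y₂ : ℝ} (h₁ : FlowReturn T D a y₀ y₁)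
    (h₂ : FlowReturn T D a y₀ y₂) : y₁ = y₂ := by
  obtain ⟨x, y, hs, hx, hy, τ, hτ, hneg, hxτ, hyτ⟩ := h₁
  obtain ⟨x', y', hs', hx', hy', τ', hτ', hneg', hxτ', hyτ'⟩ := h₂
  obtain ⟨rfl, rfl⟩ := hs.unique hs' (hx.trans hx'.symm) (hy.trans hy'.symm)
  rcases lt_trichotomy τ τ' with h | rfl | h
  · exact absurd hxτ (hneg' τ hτ h).ne
  · exact hyτ.symm.trans hyτ'
  · exact absurd hxτ' (hneg τ' hτ' h).ne

/-- The graph is the graph of a function. -/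
theorem LeftGraph.unique {T D a y₀ y₁ y₂ : ℝ} (h₁ : LeftGraph T D a y₀ y₁)
    (h₂ : LeftGraph T D a y₀ y₂) : y₁ = y₂ := by
  obtain ⟨-, h₁ | ⟨e₁, f₁, n₁, -⟩⟩ := h₁ <;> obtain ⟨-, h₂ | ⟨e₂, f₂, n₂, -⟩⟩ := h₂
  · exact h₁.unique h₂
  · exact absurd ⟨y₁, e₂ ▸ h₁⟩ n₂
  · exact absurd ⟨y₂, e₁ ▸ h₂⟩ n₁
  · rw [f₁, f₂]

theorem leftGraph_iff {T D a y₀ y₁ : ℝ} :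
    LeftGraph T D a y₀ y₁ ↔ y₀ ∈ leftDomain T D a ∧ leftMap T D a y₀ = y₁ := by
  constructor
  · intro h
    have hex : ∃ y₁ : ℝ, LeftGraph T D a y₀ y₁ := ⟨y₁, h⟩
    refine ⟨hex, ?_⟩
    rw [leftMap, dif_pos hex]
    exact hex.choose_spec.unique h
  · rintro ⟨hex, rfl⟩
    have hex' : ∃ y₁ : ℝ, LeftGraph T D a y₀ y₁ := hex
    rw [leftMap, dif_pos hex']
    exact hex'.choose_spec

end PoincareHalfMap

open Filter Topology

namespace PoincareHalfMap

/-! Let `τ` be the flight time of `y₀`. The Wronskian of two homogeneous solutions is multiplied by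
`exp (T τ)` over this time. Applied to velocity and acceleration, this gives W(P) = exp(T τ) W(y₀)
(`IsSolution.W_eq`). Applied to the velocity and the variation (q, s) of the orbit with y₀, and
combined with implicit differentiation of `τ`, it gives P' = y₀ exp(T τ) / P. Eliminating the
exponential yields the first formula; differentiating it yields the second, where the terms in D y₀²
P² cancel.

This needs W(y₀) ≠ 0 and P(y₀) ≠ 0. If W(y₀) = 0, the orbit stays on an invariant line and cannot
return (`W_ne_zero_of_flowReturn`). If P(y₀) = 0, the return is tangential, which forces a < 0 and a
focus or centre; then no smaller starting point returns (`not_flowReturn_of_tangent`), so y₀ is not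
interior. -/

theorem hasDerivAt_exp_const_mul (c t : ℝ) :
    HasDerivAt (fun t => Real.exp (c * t)) (Real.exp (c * t) * c) t := by
  have h : HasDerivAt (fun t => c * t) c t := by simpa using (hasDerivAt_id t).const_mul c
  exact h.exp

theorem eq_exp_mul_of_hasDerivAt {f : ℝ → ℝ} {c : ℝ} (hf : ∀ t, HasDerivAt f (c * f t) t) (t : ℝ) :
    f t = Real.exp (c * t) * f 0 := by
  have hd : ∀ t, HasDerivAt (fun t => Real.exp (-c * t) * f t) 0 t := fun t =>
    HasDerivAt.congr_deriv ((hasDerivAt_exp_const_mul (-c) t).mul (hf t) :) (by ring)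
  have h := is_const_of_deriv_eq_zero (fun t => (hd t).differentiableAt) (fun t => (hd t).deriv) t 0
  simp only [mul_zero, Real.exp_zero, one_mul] at h
  rw [← h, ← mul_assoc, ← Real.exp_add]
  simp

/-! ### Superposition and Wronskians -/

namespace IsSolution

variable {T D a : ℝ} {x y q s : ℝ → ℝ}

theorem add_const_mul (h : IsSolution T D a x y) (hq : IsSolution T D 0 q s) (c : ℝ) :
    IsSolution T D a (fun t => x t + c * q t) (fun t => y t + c * s t) := fun t => by
  refine ⟨?_, ?_⟩
  · refine HasDerivAt.congr_deriv ((h t).1.add ((hq t).1.const_mul c) :) ?_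
    ring
  · refine HasDerivAt.congr_deriv ((h t).2.add ((hq t).2.const_mul c) :) ?_
    ring

theorem const_mul_sub {x' y' : ℝ → ℝ} (h : IsSolution T D a x y) (h' : IsSolution T D a x' y')
    (c : ℝ) : IsSolution T D 0 (fun t => c * (x t - x' t)) (fun t => c * (y t - y' t)) :=
  fun t => by
  refine ⟨?_, ?_⟩
  · refine HasDerivAt.congr_deriv (((h t).1.sub (h' t).1).const_mul c :) ?_
    ring
  · refine HasDerivAt.congr_deriv (((h t).2.sub (h' t).2).const_mul c :) ?_
    ring

theorem comp_add_const (h : IsSolution T D a x y) (τ : ℝ) :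
    IsSolution T D a (fun t => x (t + τ)) (fun t => y (t + τ)) :=
  fun t => ⟨(h (t + τ)).1.comp_add_const t τ, (h (t + τ)).2.comp_add_const t τ⟩

theorem continuous_fst (h : IsSolution T D a x y) : Continuous x :=
  continuous_iff_continuousAt.2 fun t => (h t).1.continuousAt

/-- Liouville's formula: the velocity of an affine solution solves the homogeneous system, whose
trace is `T`. -/
theorem wronskian (h : IsSolution T D a x y) (hq : IsSolution T D 0 q s) (t : ℝ) :
    (T * x t - y t) * s t - (D * x t - a) * q t =
      Real.exp (T * t) * ((T * x 0 - y 0) * s 0 - (D * x 0 - a) * q 0) := by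
  refine eq_exp_mul_of_hasDerivAt
    (f := fun t => (T * x t - y t) * s t - (D * x t - a) * q t) (fun t => ?_) t
  refine HasDerivAt.congr_deriv (((((h t).1.const_mul T).sub (h t).2).mul (hq t).2).sub
    ((((h t).1.const_mul D).sub_const a).mul (hq t).1) :) ?_
  simp only [Pi.sub_apply]
  ring

theorem velocity (h : IsSolution T D a x y) :
    IsSolution T D 0 (fun t => T * x t - y t) (fun t => D * x t - a) := fun t => by
  refine ⟨((h t).1.const_mul T).sub (h t).2, ?_⟩
  simpa using ((h t).1.const_mul D).sub_const a

/-- `W` is multiplied by `exp (T τ)` between two points of an orbit on the section `x = 0`. -/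
theorem W_eq (h : IsSolution T D a x y) (h0 : x 0 = 0) {τ : ℝ} (hτ : x τ = 0) :
    W T D a (y τ) = Real.exp (T * τ) * W T D a (y 0) := by
  -- At a point (0, y) the velocity is (-y, -a) and the acceleration (a - T y, -D y); their
  -- determinant is W(y).
  have := h.wronskian h.velocity.velocity τ
  simp only [h0, hτ] at this
  unfold W
  linear_combination this

end IsSolution

variable {T D a : ℝ} {x y : ℝ → ℝ}

/-! ### Returning orbits and obstructions to return -/

theorem nonpos_of_return (h : IsSolution T D a x y) {τ : ℝ} (hτ : 0 < τ)
    (hneg : ∀ t, 0 < t → t < τ → x t < 0) (hxτ : x τ = 0) : y τ ≤ 0 := by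
  by_contra! hy
  have hd := (h τ).1
  rw [hxτ] at hd
  have := hd.hasDerivWithinAt (s := Set.Iio τ)
  rw [hasDerivWithinAt_iff_tendsto_slope' (by simp)] at this
  have h0 : 0 ≤ T * 0 - y τ := by
    refine ge_of_tendsto this ?_
    filter_upwards [Ioo_mem_nhdsLT hτ] with t ht
    rw [slope_def_field, hxτ, sub_zero]
    have h1 := hneg t ht.1 ht.2
    have h2 := ht.2
    apply div_nonneg_of_nonpos <;> linarith
  linarith

/-- A zero of `W` makes the line a x = y₀ (y - y₀) invariant. It meets the section only at y₀ > 0,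
whereas a return has y ≤ 0. -/
theorem W_ne_zero_of_flowReturn {y₀ y₁ : ℝ} (hy₀ : 0 < y₀) (hr : FlowReturn T D a y₀ y₁) :
    W T D a y₀ ≠ 0 := by
  obtain ⟨x, y, h, hx, hy, τ, hτ, hneg, hxτ, hyτ⟩ := hr
  intro hW
  have hle := nonpos_of_return h hτ hneg hxτ
  have key := eq_exp_mul_of_hasDerivAt (f := fun t => a * x t - y₀ * (y t - y₀)) (c := a / y₀)
    (fun t => by
      refine HasDerivAt.congr_deriv (((h t).1.const_mul a).sub (((h t).2.sub_const y₀).const_mul y₀) :) ?_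
      unfold W at hW
      field_simp
      linear_combination (-x t) * hW) τ
  simp only [hx, hy, hxτ] at key
  have : y₀ * (y τ - y₀) = 0 := by linear_combination -key
  rcases mul_eq_zero.1 this with h1 | h1 <;> linarith

/-- With a real eigenvalue, an orbit with `a ≤ 0` and `y₀ > 0` does not come back. -/
theorem pos_of_real_eigenvalue (h : IsSolution T D a x y) (ha : a ≤ 0) {l : ℝ}
    (hl : l ^ 2 - T * l + D = 0) (hx : x 0 = 0) (hy : 0 < y 0) {τ : ℝ} (hτ : 0 < τ)
    (hxτ : x τ = 0) : 0 < y τ := by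
  -- The functional y - l x is a left eigenvector for `l`, so only the forcing term -a ≥ 0 survives.
  have hd : ∀ t, HasDerivAt (fun t => Real.exp (-l * t) * (y t - l * x t))
      (Real.exp (-l * t) * (-a)) t := fun t => by
    refine HasDerivAt.congr_deriv
      ((hasDerivAt_exp_const_mul (-l) t).mul ((h t).2.sub ((h t).1.const_mul l)) :) ?_
    simp only [Pi.sub_apply]
    linear_combination (Real.exp (-l * t) * x t) * hl
  have hm : Monotone fun t => Real.exp (-l * t) * (y t - l * x t) :=
    monotone_of_deriv_nonneg (fun t => (hd t).differentiableAt) fun t => by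
      rw [(hd t).deriv]
      exact mul_nonneg (Real.exp_pos _).le (by linarith)
  have := hm hτ.le
  simp only [hx, hxτ, mul_zero, Real.exp_zero, sub_zero, one_mul] at this
  exact pos_of_mul_pos_right (hy.trans_le this) (Real.exp_pos _).le

/-! ### Focus and centre cases -/

section Focus

/-- The first component of the homogeneous flow with initial velocity tangent to the section. -/
noncomputable def focusProfile (σ ω t : ℝ) : ℝ :=
  Real.exp (σ * t) * (Real.cos (ω * t) - σ / ω * Real.sin (ω * t))

variable {σ ω : ℝ}

theorem hasDerivAt_exp_mul_sin (σ ω t : ℝ) :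
    HasDerivAt (fun t => Real.exp (σ * t) * Real.sin (ω * t))
      (Real.exp (σ * t) * (σ * Real.sin (ω * t) + ω * Real.cos (ω * t))) t := by
  have h2 : HasDerivAt (fun t => ω * t) ω t := by simpa using (hasDerivAt_id t).const_mul ω
  refine HasDerivAt.congr_deriv ((hasDerivAt_exp_const_mul σ t).mul h2.sin :) ?_
  ring

theorem hasDerivAt_exp_mul_cos (σ ω t : ℝ) :
    HasDerivAt (fun t => Real.exp (σ * t) * Real.cos (ω * t))
      (Real.exp (σ * t) * (σ * Real.cos (ω * t) - ω * Real.sin (ω * t))) t := by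
  have h2 : HasDerivAt (fun t => ω * t) ω t := by simpa using (hasDerivAt_id t).const_mul ω
  refine HasDerivAt.congr_deriv ((hasDerivAt_exp_const_mul σ t).mul h2.cos :) ?_
  ring

theorem hasDerivAt_focusProfile (hω : ω ≠ 0) (t : ℝ) :
    HasDerivAt (focusProfile σ ω)
      (-((σ ^ 2 + ω ^ 2) / ω * (Real.exp (σ * t) * Real.sin (ω * t)))) t := by
  have h := (hasDerivAt_exp_mul_cos σ ω t).sub ((hasDerivAt_exp_mul_sin σ ω t).const_mul (σ / ω))
  have e : focusProfile σ ω = (fun t => Real.exp (σ * t) * Real.cos (ω * t)) -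
      fun t => σ / ω * (Real.exp (σ * t) * Real.sin (ω * t)) := by
    ext u
    simp only [focusProfile, Pi.sub_apply]
    ring
  rw [e]
  refine h.congr_deriv ?_
  field_simp
  ring

theorem focusProfile_zero : focusProfile σ ω 0 = 1 := by simp [focusProfile]

/-- The derivative has the sign of -sin(ω t), so within half a turn the value 1 at t = 0 is a strict
maximum. -/
theorem focusProfile_lt_one (hω : 0 < ω) {t : ℝ} (ht : |t| ≤ Real.pi / ω) (h0 : t ≠ 0) :
    focusProfile σ ω t < 1 := by
  have hc : Continuous (focusProfile σ ω) :=
    continuous_iff_continuousAt.2 fun t => (hasDerivAt_focusProfile hω.ne' t).continuousAt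
  have hk : 0 < (σ ^ 2 + ω ^ 2) / ω := by positivity
  obtain ⟨h1, h2⟩ := abs_le.1 ht
  rcases lt_or_gt_of_ne h0 with h | h
  · have hm : StrictMonoOn (focusProfile σ ω) (Set.Icc (-(Real.pi / ω)) 0) := by
      refine strictMonoOn_of_deriv_pos (convex_Icc _ _) hc.continuousOn fun u hu => ?_
      rw [interior_Icc] at hu
      rw [(hasDerivAt_focusProfile hω.ne' u).deriv]
      have : Real.sin (ω * u) < 0 := by
        refine Real.sin_neg_of_neg_of_neg_pi_lt (mul_neg_of_pos_of_neg hω hu.2) ?_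
        have := mul_lt_mul_of_pos_left hu.1 hω
        rwa [mul_neg, mul_div_cancel₀ _ hω.ne'] at this
      have := mul_neg_of_pos_of_neg hk (mul_neg_of_pos_of_neg (Real.exp_pos (σ * u)) this)
      linarith
    have := hm ⟨h1, h.le⟩ ⟨by linarith, le_rfl⟩ h
    rwa [focusProfile_zero] at this
  · have hm : StrictAntiOn (focusProfile σ ω) (Set.Icc 0 (Real.pi / ω)) := by
      refine strictAntiOn_of_deriv_neg (convex_Icc _ _) hc.continuousOn fun u hu => ?_
      rw [interior_Icc] at hu
      rw [(hasDerivAt_focusProfile hω.ne' u).deriv]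
      have : 0 < Real.sin (ω * u) := by
        refine Real.sin_pos_of_pos_of_lt_pi (mul_pos hω hu.1) ?_
        have := mul_lt_mul_of_pos_left hu.2 hω
        rwa [mul_div_cancel₀ _ hω.ne'] at this
      have := mul_pos hk (mul_pos (Real.exp_pos (σ * u)) this)
      linarith
    have := hm ⟨le_rfl, by linarith⟩ ⟨h.le, h2⟩ h
    rwa [focusProfile_zero] at this

theorem focusProfile_add_period (hω : ω ≠ 0) (t : ℝ) :
    focusProfile σ ω (t + 2 * Real.pi / ω) =
      Real.exp (σ * (2 * Real.pi / ω)) * focusProfile σ ω t := by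
  have : ω * (t + 2 * Real.pi / ω) = ω * t + 2 * Real.pi := by field_simp
  simp only [focusProfile, this, Real.cos_add_two_pi, Real.sin_add_two_pi, mul_add σ, Real.exp_add]
  ring

/-- The first component of the orbit through `(0, y₀)` in the focus and centre cases. -/
theorem IsSolution.eq_focus (h : IsSolution T D a x y) (hσ : T = 2 * σ) (hω : ω ≠ 0)
    (hD : D = σ ^ 2 + ω ^ 2) (hx : x 0 = 0) (t : ℝ) :
    x t = a / D * (1 - focusProfile σ ω t) -
      y 0 / ω * (Real.exp (σ * t) * Real.sin (ω * t)) := by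
  have hD0 : D ≠ 0 := by rw [hD]; positivity
  let X : ℝ → ℝ := fun t => a / D * (1 - focusProfile σ ω t) -
      y 0 / ω * (Real.exp (σ * t) * Real.sin (ω * t))
  let X' : ℝ → ℝ := fun t => a / ω * (Real.exp (σ * t) * Real.sin (ω * t)) -
      y 0 / ω * (Real.exp (σ * t) * (σ * Real.sin (ω * t) + ω * Real.cos (ω * t)))
  have hX : ∀ t, HasDerivAt X (X' t) t := fun t => by
    refine HasDerivAt.congr_deriv ((((hasDerivAt_focusProfile (σ := σ) hω t).const_sub 1).const_mul (a / D)).sub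
      ((hasDerivAt_exp_mul_sin σ ω t).const_mul (y 0 / ω)) :) ?_
    simp only [X', ← hD]
    field_simp
  -- This second component makes the first equation automatic; uniqueness then identifies `X` with
  -- `x`.
  have hsol : IsSolution T D a X (fun t => T * X t - X' t) := fun t => by
    refine ⟨by simpa using hX t, ?_⟩
    have h2 := ((hX t).const_mul T).sub (((hasDerivAt_exp_mul_sin σ ω t).const_mul (a / ω)).sub
      ((((hasDerivAt_exp_mul_sin σ ω t).const_mul σ).add
        ((hasDerivAt_exp_mul_cos σ ω t).const_mul ω)).const_mul (y 0 / ω)))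
    have e : (fun t => T * X t - X' t) = (fun t => T * X t) -
        ((fun t => a / ω * (Real.exp (σ * t) * Real.sin (ω * t))) - fun t => y 0 / ω *
          ((fun t => σ * (Real.exp (σ * t) * Real.sin (ω * t))) +
            fun t => ω * (Real.exp (σ * t) * Real.cos (ω * t))) t) := by
      ext u
      simp only [X', Pi.sub_apply, Pi.add_apply]
      ring
    rw [e]
    refine h2.congr_deriv ?_
    simp only [X, X', focusProfile]
    rw [hσ]
    field_simp
    rw [hD]
    ring
  have h0 : X 0 = 0 := by simp [X, focusProfile]
  have h0' : X' 0 = - y 0 := by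
    simp only [X', mul_zero, Real.exp_zero, Real.sin_zero, Real.cos_zero]
    field_simp
    ring
  exact congrFun (h.unique hsol (hx.trans h0.symm) (by simp [h0, h0'])).1 t

/-- The tangent orbit has x ≤ 0 throughout (0, S] and x(S) < 0, where S = 2π/ω. The orbit of `u` is
shown to have x < 0 at any supposed return time: by the explicit formula up to π/ω, by comparison
with the tangent orbit from there to S, and by quasi-periodicity beyond S. -/
theorem not_flowReturn_of_focus (ha : a < 0) (hσ : T = 2 * σ) (hω : 0 < ω)
    (hD : D = σ ^ 2 + ω ^ 2) {y₀ u : ℝ} (hr : FlowReturn T D a y₀ 0) (hy₀ : 0 < y₀) (hu : 0 < u)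
    (huy : u < y₀) (z : ℝ) : ¬ FlowReturn T D a u z := by
  obtain ⟨x, y, h, hx, hy, τ, hτ, hneg, hxτ, hyτ⟩ := hr
  have hDpos : 0 < D := by rw [hD]; positivity
  have haD : a / D < 0 := div_neg_of_neg_of_pos ha hDpos
  have hpi : 0 < Real.pi / ω := by positivity
  have hper : 2 * Real.pi / ω = Real.pi / ω + Real.pi / ω := by ring
  have h1 := h.eq_focus hσ hω.ne' hD hx
  -- Restart the clock at the tangency: the orbit is then at the origin and the sine term vanishes.
  have h2 : ∀ t, x t = a / D * (1 - focusProfile σ ω (t - τ)) := fun t => by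
    have := (h.comp_add_const τ).eq_focus hσ hω.ne' hD (by simpa using hxτ) (t - τ)
    simpa [hyτ] using this
  have hlt : ∀ t, |t| ≤ Real.pi / ω → t ≠ 0 → a / D * (1 - focusProfile σ ω t) < 0 :=
    fun t ht h0 => mul_neg_of_neg_of_pos haD (by linarith [focusProfile_lt_one (σ := σ) hω ht h0])
  have hτpi : Real.pi / ω < τ := by
    by_contra! hle
    have := hlt (0 - τ) (by rw [zero_sub, abs_neg, abs_of_pos hτ]; exact hle) (by linarith)
    rw [← h2, hx] at this
    exact lt_irrefl _ this
  have hafter : ∀ t, τ < t → t ≤ 2 * Real.pi / ω → x t < 0 := fun t h3 h4 => by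
    rw [h2]
    exact hlt _ (by rw [abs_of_pos (by linarith)]; linarith) (by linarith)
  have hnonpos : ∀ t, 0 < t → t ≤ 2 * Real.pi / ω → x t ≤ 0 := fun t h3 h4 => by
    rcases lt_trichotomy t τ with h5 | h5 | h5
    · exact (hneg t h3 h5).le
    · rw [h5, hxτ]
    · exact (hafter t h5 h4).le
  set S := 2 * Real.pi / ω with hS
  set c := Real.exp (σ * S) with hc
  have hcpos : 0 < c := Real.exp_pos _
  have hcos : ω * S = 2 * Real.pi := by rw [hS]; field_simp
  have hperiod : ∀ t, focusProfile σ ω (t + S) = c * focusProfile σ ω t :=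
    focusProfile_add_period hω.ne'
  have hSpos : 0 < S := by positivity
  have hxS : x S < 0 := by
    rcases lt_trichotomy S τ with h5 | h5 | h5
    · exact hneg S hSpos h5
    -- After a full turn x' = -y₀ exp(σ S) ≠ 0, which is incompatible with tangency.
    · exfalso
      have hd := (h τ).1
      have hd' : HasDerivAt x (a / D * -(-((σ ^ 2 + ω ^ 2) / ω *
          (Real.exp (σ * τ) * Real.sin (ω * τ)))) - y 0 / ω *
          (Real.exp (σ * τ) * (σ * Real.sin (ω * τ) + ω * Real.cos (ω * τ)))) τ := by
        have e : x = fun t => a / D * (1 - focusProfile σ ω t) -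
          y 0 / ω * (Real.exp (σ * t) * Real.sin (ω * t)) := funext h1
        rw [e]
        exact ((((hasDerivAt_focusProfile (σ := σ) hω.ne' τ).const_sub 1).const_mul (a / D)).sub
          ((hasDerivAt_exp_mul_sin σ ω τ).const_mul (y 0 / ω)))
      have := hd.unique hd'
      rw [hxτ, hyτ, hy, ← h5, hcos, Real.sin_two_pi, Real.cos_two_pi] at this
      have h6 : y₀ * Real.exp (σ * S) = 0 := by
        have e : y₀ * Real.exp (σ * S) = y₀ / ω * (Real.exp (σ * S) * (σ * 0 + ω * 1)) := by
          field_simp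
          ring
        linarith
      have := mul_pos hy₀ hcpos
      linarith
    · exact hafter S h5 le_rfl
  have hcS : a / D * (1 - c) < 0 := by
    have := h1 S
    rw [hcos, Real.sin_two_pi, ← zero_add S, hperiod, zero_add, focusProfile_zero] at this
    linarith
  rintro ⟨x', y', h', hx', hy', τ', hτ', hneg', hxτ', -⟩
  have h1' := h'.eq_focus hσ hω.ne' hD hx'
  rw [hy'] at h1'
  have hcomp : ∀ t, x' t = x t + (y₀ - u) / ω * (Real.exp (σ * t) * Real.sin (ω * t)) :=
    fun t => by rw [h1', h1, hy]; ring
  rcases le_or_gt τ' S with h5 | h5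
  · rcases le_or_gt τ' (Real.pi / ω) with h6 | h6
    · have h7 := hlt τ' (by rwa [abs_of_pos hτ']) hτ'.ne'
      have h8 : 0 ≤ Real.sin (ω * τ') := by
        refine Real.sin_nonneg_of_nonneg_of_le_pi (by positivity) ?_
        rw [le_div_iff₀ hω] at h6
        linarith
      have h9 : 0 ≤ u / ω * (Real.exp (σ * τ') * Real.sin (ω * τ')) := by positivity
      have := h1' τ'
      linarith
    · rcases h5.lt_or_eq with h7 | h7
      · have h8 : Real.sin (ω * τ') < 0 := by
          rw [← Real.sin_sub_two_pi]
          have i1 := mul_lt_mul_of_pos_left h6 hω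
          have i2 := mul_lt_mul_of_pos_left h7 hω
          rw [mul_div_cancel₀ _ hω.ne'] at i1
          exact Real.sin_neg_of_neg_of_neg_pi_lt (by linarith) (by linarith)
        have h9 : (y₀ - u) / ω * (Real.exp (σ * τ') * Real.sin (ω * τ')) < 0 :=
          mul_neg_of_pos_of_neg (div_pos (by linarith) hω)
            (mul_neg_of_pos_of_neg (Real.exp_pos _) h8)
        have := hcomp τ'
        have := hnonpos τ' hτ' h5
        linarith
      · have := hcomp S
        rw [hcos, Real.sin_two_pi, ← h7, hxτ', h7] at this
        linarith
  · have h6 := hneg' (τ' - S) (by linarith) (by linarith)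
    have h7 : x' τ' = a / D * (1 - c) + c * x' (τ' - S) := by
      have e : τ' = τ' - S + S := by ring
      have e1 : Real.exp (σ * τ') = c * Real.exp (σ * (τ' - S)) := by
        rw [hc, ← Real.exp_add]; ring_nf
      have e2 : Real.sin (ω * τ') = Real.sin (ω * (τ' - S)) := by
        rw [mul_sub, hcos, Real.sin_sub_two_pi]
      have e3 := hperiod (τ' - S)
      rw [sub_add_cancel] at e3
      rw [h1', h1' (τ' - S), e1, e2, e3]
      ring
    have := mul_neg_of_pos_of_neg hcpos h6
    linarith

end Focus

/-! ### Tangential returns -/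

/-- If the orbit of `y₀ > 0` returns tangentially, at the origin, then no orbit starting at
a point `u ∈ (0, y₀)` returns. -/
theorem not_flowReturn_of_tangent {y₀ u : ℝ} (hr : FlowReturn T D a y₀ 0) (hu : 0 < u)
    (huy : u < y₀) (z : ℝ) : ¬ FlowReturn T D a u z := by
  have hy₀ := hu.trans huy
  have ha : a < 0 := by
    have hW := W_ne_zero_of_flowReturn hy₀ hr
    obtain ⟨x, y, h, hx, hy, τ, hτ, hneg, hxτ, hyτ⟩ := hr
    have hWeq := h.W_eq hx hxτ
    rw [hyτ, hy] at hWeq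
    have ha0 : a ≠ 0 := by
      rintro rfl
      simp only [W] at hWeq hW
      rcases mul_eq_zero.1 (show Real.exp (T * τ) * (D * y₀ ^ 2 - 0 * T * y₀ + 0 ^ 2) = 0 by
        rw [← hWeq]; ring) with h1 | h1
      · exact (Real.exp_pos _).ne' h1
      · exact hW h1
    refine lt_of_le_of_ne ?_ ha0
    -- At the tangency x' = 0 and x'' = a. If a > 0, then x decreases to 0 just before `τ`, so it is
    -- positive there.
    by_contra! hpos
    have hv := h.velocity τ
    have hlt : ∀ᶠ t in 𝓝[<] τ, T * x t - y t < 0 := by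
      have := hv.1.hasDerivWithinAt (s := Set.Iio τ)
      rw [hasDerivWithinAt_iff_tendsto_slope' (by simp)] at this
      have := this.eventually_const_lt (u := 0) (by simp [hxτ, hyτ, hpos])
      filter_upwards [this, self_mem_nhdsWithin] with t ht htτ
      rw [slope_def_field, hxτ, hyτ] at ht
      have htτ : t - τ < 0 := sub_neg.2 htτ
      by_contra! hle
      have := div_nonpos_of_nonneg_of_nonpos (sub_nonneg.2 (show T * 0 - 0 ≤ T * x t - y t by
        linarith)) htτ.le
      linarith
    obtain ⟨l, hl, hl'⟩ := (mem_nhdsLT_iff_exists_Ioo_subset' hτ).1 (hlt.and (Ioo_mem_nhdsLT hτ))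
    have hanti : StrictAntiOn x (Set.Icc ((l + τ) / 2) τ) := by
      refine strictAntiOn_of_deriv_neg (convex_Icc _ _) h.continuous_fst.continuousOn
        fun t ht => ?_
      rw [interior_Icc] at ht
      rw [(h t).1.deriv]
      have hl : l < τ := hl
      exact (hl' ⟨by linarith [ht.1], ht.2⟩).1
    have hl : l < τ := hl
    have hm : (l + τ) / 2 < τ := by linarith
    have h1 := hanti ⟨le_rfl, hm.le⟩ ⟨hm.le, le_rfl⟩ hm
    have hmem := (hl' (show (l + τ) / 2 ∈ Set.Ioo l τ from ⟨by linarith, hm⟩)).2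
    have h2 := hneg _ hmem.1 hmem.2
    linarith
  have hfoc : T ^ 2 < 4 * D := by
    by_contra! hle
    obtain ⟨x, y, h, hx, hy, τ, hτ, hneg, hxτ, hyτ⟩ := hr
    have hs := Real.sq_sqrt (sub_nonneg.2 hle)
    have := pos_of_real_eigenvalue h ha.le (l := (T + √(T ^ 2 - 4 * D)) / 2)
      (by linear_combination hs / 4) hx (hy ▸ hy₀) hτ hxτ
    linarith
  have hs := Real.sq_sqrt (show 0 ≤ D - T ^ 2 / 4 by linarith)
  exact not_flowReturn_of_focus (σ := T / 2) (ω := √(D - T ^ 2 / 4)) ha (by ring)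
    (Real.sqrt_pos.2 (by linarith)) (by linear_combination -hs) hr hy₀ hu huy z

/-! ### Regularity of the return time -/

/-- Implicit differentiation of `x (τ u) + (u - u₀) q (τ u) = 0`. -/
theorem hasDerivAt_of_implicit {x q τ : ℝ → ℝ} {u₀ m : ℝ} (hx : HasDerivAt x m (τ u₀))
    (hx0 : x (τ u₀) = 0) (hm : m ≠ 0) (hq : ContinuousAt q (τ u₀)) (hτ : ContinuousAt τ u₀)
    (h : ∀ᶠ u in 𝓝 u₀, x (τ u) + (u - u₀) * q (τ u) = 0) :
    HasDerivAt τ (-q (τ u₀) / m) u₀ := by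
  have hd : Tendsto (fun u => dslope x (τ u₀) (τ u)) (𝓝 u₀) (𝓝 m) := by
    have := (continuousAt_dslope_same.2 hx.differentiableAt).tendsto.comp hτ.tendsto
    rwa [dslope_same, hx.deriv] at this
  have hlim := ((hq.tendsto.comp hτ.tendsto).neg.div hd hm)
  rw [hasDerivAt_iff_tendsto_slope]
  refine (hlim.mono_left nhdsWithin_le_nhds).congr' ?_
  filter_upwards [nhdsWithin_le_nhds h, nhdsWithin_le_nhds (hd.eventually_ne hm),
    self_mem_nhdsWithin] with u h1 h2 h3
  have h3 : u - u₀ ≠ 0 := sub_ne_zero.2 h3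
  have h4 := sub_smul_dslope x (τ u₀) (τ u)
  rw [hx0, smul_eq_mul] at h4
  simp only [Function.comp, Pi.div_apply, slope_def_field]
  rw [div_eq_div_iff h2 h3]
  linear_combination -h1 - h4

/-- The return time depends continuously on the starting point at a transversal return. -/
theorem eventually_abs_sub_lt {x q : ℝ → ℝ} (hx : Differentiable ℝ x) (hq : Differentiable ℝ q)
    (hx0 : x 0 = 0) (hq0 : q 0 = 0) (hx0' : deriv x 0 < 0) {τ : ℝ}
    (hτ : 0 < τ) (hneg : ∀ t, 0 < t → t < τ → x t < 0) (hxτ : x τ = 0) (hxτ' : 0 < deriv x τ)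
    {δ : ℝ} (hδ : 0 < δ) :
    ∀ᶠ c in 𝓝 (0 : ℝ), ∀ r, 0 < r → (∀ t, 0 < t → t < r → x t + c * q t < 0) →
      x r + c * q r = 0 → |r - τ| < δ := by
  have hup : ∀ᶠ t in 𝓝[>] τ, 0 < x t := by
    have := (hx τ).hasDerivAt.hasDerivWithinAt (s := Set.Ioi τ)
    rw [hasDerivWithinAt_iff_tendsto_slope' (by simp)] at this
    filter_upwards [this.eventually_const_lt hxτ', self_mem_nhdsWithin] with t ht htτ
    rw [slope_def_field, hxτ, sub_zero] at ht
    exact (div_pos_iff_of_pos_right (sub_pos.2 htτ)).1 ht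
  -- Positivity at `b` persists for small `c` and excludes late returns.
  obtain ⟨b, hb, hτb, hbδ⟩ := (hup.and (Ioo_mem_nhdsGT (show τ < τ + δ by linarith))).exists
  have e1 : ∀ᶠ c in 𝓝 (0 : ℝ), 0 < x b + c * q b := by
    have : ContinuousAt (fun c : ℝ => x b + c * q b) 0 := by fun_prop
    exact this.eventually_const_lt (by simpa using hb)
  have cont : ∀ {f : ℝ → ℝ}, Differentiable ℝ f → Continuous (dslope f 0) := fun {f} hf =>
    continuous_iff_continuousAt.2 fun t => by
      rcases eq_or_ne t 0 with rfl | ht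
      · exact continuousAt_dslope_same.2 (hf _)
      · exact (continuousAt_dslope_of_ne ht).2 (hf t).continuousAt
  have hfac : ∀ {f : ℝ → ℝ}, f 0 = 0 → ∀ t, f t = t * dslope f 0 t := fun {f} hf t => by
    have := sub_smul_dslope f 0 t
    rw [hf, smul_eq_mul, sub_zero, sub_zero] at this
    exact this.symm
  -- Dividing out the common zero at t = 0 leaves a function that is strictly negative up to the
  -- endpoint 0, so compactness excludes early returns.
  have e2 : ∀ᶠ c in 𝓝 (0 : ℝ), ∀ t ∈ Set.Icc 0 (τ - δ), dslope x 0 t + c * dslope q 0 t < 0 := by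
    refine isCompact_Icc.eventually_forall_of_forall_eventually fun t ht => ?_
    have h1 := cont hx
    have h2 := cont hq
    have : Continuous fun z : ℝ × ℝ => dslope x 0 z.2 + z.1 * dslope q 0 z.2 := by fun_prop
    refine this.continuousAt.eventually_lt_const ?_
    simp only [zero_mul, add_zero]
    rcases ht.1.eq_or_lt with rfl | h0
    · rwa [dslope_same]
    · have h3 := hneg t h0 (by linarith [ht.2])
      rw [hfac hx0 t] at h3
      exact (pos_iff_neg_of_mul_neg h3).1 h0
  filter_upwards [e1, e2] with c h1 h2 r hr hrneg hr0
  rw [abs_lt]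
  constructor
  · by_contra! hle
    have h3 := h2 r ⟨hr.le, by linarith⟩
    have h4 := mul_neg_of_pos_of_neg hr h3
    rw [hfac hx0 r, hfac hq0 r] at hr0
    linarith
  · by_contra! hle
    have := hrneg b (hτ.trans hτb) (by linarith)
    linarith

/-! ### The half-map on the interior of its domain -/

theorem pos_of_mem_interior {y₀ : ℝ} (h : y₀ ∈ interior (leftDomain T D a)) : 0 < y₀ := by
  have hsub : leftDomain T D a ⊆ Set.Ici 0 := fun y hy => by
    obtain ⟨z, hz⟩ := hy
    exact hz.1
  have := interior_mono hsub h
  rwa [interior_Ici] at this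

theorem flowReturn_of_mem_interior {y₀ : ℝ} (h : y₀ ∈ interior (leftDomain T D a)) :
    FlowReturn T D a y₀ (leftMap T D a y₀) := by
  have h1 := leftGraph_iff.2 ⟨interior_subset h, rfl⟩
  rcases h1.2 with h2 | h2
  · exact h2
  · exact absurd h2.1 (pos_of_mem_interior h).ne'

theorem leftMap_neg {y₀ : ℝ} (h : y₀ ∈ interior (leftDomain T D a)) :
    leftMap T D a y₀ < 0 := by
  have hr := flowReturn_of_mem_interior h
  refine lt_of_le_of_ne ?_ fun h0 => ?_
  · obtain ⟨x, y, hs, -, -, τ, hτ, hneg, hxτ, hyτ⟩ := hr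
    exact hyτ ▸ nonpos_of_return hs hτ hneg hxτ
  · rw [h0] at hr
    have hev : ∀ᶠ u in 𝓝[<] y₀, u ∈ interior (leftDomain T D a) :=
      nhdsWithin_le_nhds (isOpen_interior.mem_nhds h)
    obtain ⟨u, hu, huy⟩ := (hev.and self_mem_nhdsWithin).exists
    exact not_flowReturn_of_tangent hr (pos_of_mem_interior hu) huy _ (flowReturn_of_mem_interior hu)

/-- The difference quotient of two returning orbits with nearby starting points is such a solution;
no matrix exponential is needed. -/
theorem exists_homogeneous_solution {y₀ : ℝ} (h : y₀ ∈ interior (leftDomain T D a)) :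
    ∃ q s : ℝ → ℝ, IsSolution T D 0 q s ∧ q 0 = 0 ∧ s 0 = 1 := by
  have hev : ∀ᶠ u in 𝓝[<] y₀, u ∈ interior (leftDomain T D a) :=
    nhdsWithin_le_nhds (isOpen_interior.mem_nhds h)
  obtain ⟨u, hu, huy⟩ := (hev.and self_mem_nhdsWithin).exists
  obtain ⟨x, y, hs, hx, hy, -⟩ := flowReturn_of_mem_interior h
  obtain ⟨x', y', hs', hx', hy', -⟩ := flowReturn_of_mem_interior hu
  have hne : y₀ - u ≠ 0 := (sub_pos.2 huy).ne'
  exact ⟨_, _, hs.const_mul_sub hs' (y₀ - u)⁻¹, by simp [hx, hx'], by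
    simp only [hy, hy']; exact inv_mul_cancel₀ hne⟩

theorem hasDerivAt_leftMap {y₀ : ℝ} (h : y₀ ∈ interior (leftDomain T D a)) :
    HasDerivAt (leftMap T D a)
      (y₀ * W T D a (leftMap T D a y₀) / (leftMap T D a y₀ * W T D a y₀)) y₀ := by
  have hpos := pos_of_mem_interior h
  have hr := flowReturn_of_mem_interior h
  have hW := W_ne_zero_of_flowReturn hpos hr
  have hP := leftMap_neg h
  obtain ⟨q, s, hq, hq0, hs0⟩ := exists_homogeneous_solution h
  obtain ⟨x, y, hs, hx, hy, r, hrpos, hneg, hxr, hyr⟩ := hr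
  -- By superposition every nearby orbit is an affine function of `u`, so only `τ` remains to be
  -- differentiated.
  have hret : ∀ u ∈ interior (leftDomain T D a), ∃ τ : ℝ, 0 < τ ∧
      (∀ t, 0 < t → t < τ → x t + (u - y₀) * q t < 0) ∧ x τ + (u - y₀) * q τ = 0 ∧
      y τ + (u - y₀) * s τ = leftMap T D a u := fun u hu => by
    obtain ⟨x', y', hs', hx', hy', τ, hτ, hneg', hxτ', hyτ'⟩ := flowReturn_of_mem_interior hu
    obtain ⟨rfl, rfl⟩ := hs'.unique (hs.add_const_mul hq (u - y₀)) (by simp [hx, hx', hq0])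
      (by simp [hy, hy', hs0])
    exact ⟨τ, hτ, hneg', hxτ', hyτ'⟩
  choose! τ hτ hτneg hτx hτy using hret
  have hmem : ∀ᶠ u in 𝓝 y₀, u ∈ interior (leftDomain T D a) := isOpen_interior.mem_nhds h
  have hτr : τ y₀ = r := by
    have h1 := hτneg y₀ h
    have h2 := hτx y₀ h
    simp only [sub_self, zero_mul, add_zero] at h1 h2
    rcases lt_trichotomy (τ y₀) r with h3 | h3 | h3
    · exact absurd h2 (hneg _ (hτ y₀ h) h3).ne
    · exact h3
    · exact absurd hxr (h1 r hrpos h3).ne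
  have hdx : HasDerivAt x (-leftMap T D a y₀) r := by
    simpa [hxr, hyr] using (hs r).1
  have hcont : ContinuousAt τ y₀ := by
    rw [Metric.continuousAt_iff']
    intro δ hδ
    have hev := eventually_abs_sub_lt (fun t => (hs t).1.differentiableAt)
      (fun t => (hq t).1.differentiableAt) hx hq0
      (by rw [(hs 0).1.deriv, hx, hy]; linarith) hrpos hneg hxr (by rw [hdx.deriv]; linarith) hδ
    have hsub : Tendsto (fun u => u - y₀) (𝓝 y₀) (𝓝 0) := by
      simpa using (continuous_id.sub continuous_const).tendsto (f := fun u : ℝ => u - y₀) y₀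
    filter_upwards [hsub.eventually hev, hmem] with u h1 h2
    rw [Real.dist_eq, hτr]
    exact h1 _ (hτ u h2) (hτneg u h2) (hτx u h2)
  subst hτr
  have hdτ := hasDerivAt_of_implicit hdx hxr (neg_ne_zero.2 hP.ne)
    hq.continuous_fst.continuousAt hcont (hmem.mono hτx)
  have hdy := (hs (τ y₀)).2.comp y₀ hdτ
  have hds := (hq (τ y₀)).2.comp y₀ hdτ
  have hdP : HasDerivAt (fun u => y (τ u) + (u - y₀) * s (τ u)) _ y₀ :=
    (hdy.add (((hasDerivAt_id y₀).sub_const y₀).mul hds) :)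
  refine (hdP.congr_of_eventuallyEq (hmem.mono fun u hu => (hτy u hu).symm)).congr_deriv ?_
  -- The chain rule gives P' = s - a q / P at the return; the Wronskian turns this into y₀ exp(T τ)
  -- / P.
  have hWr := hs.W_eq hx hxr
  have hw := hs.wronskian hq (τ y₀)
  rw [hyr, hy] at hWr
  rw [hx, hy, hxr, hyr, hq0, hs0] at hw
  have hP0 := hP.ne
  rw [hWr]
  simp only [Function.comp, id, hxr, sub_self]
  field_simp
  linear_combination -hw

theorem hasDerivAt_deriv_leftMap {y₀ : ℝ} (h : y₀ ∈ interior (leftDomain T D a)) :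
    HasDerivAt (deriv (leftMap T D a))
      (-(a ^ 2 * (y₀ ^ 2 - leftMap T D a y₀ ^ 2) * W T D a (leftMap T D a y₀)) /
        (leftMap T D a y₀ ^ 3 * W T D a y₀ ^ 2)) y₀ := by
  have hP := (leftMap_neg h).ne
  have hW := W_ne_zero_of_flowReturn (pos_of_mem_interior h) (flowReturn_of_mem_interior h)
  have hd := hasDerivAt_leftMap h
  have hdW : ∀ u, HasDerivAt (W T D a) (2 * D * u - a * T) u := fun u => by
    have h1 := (((hasDerivAt_pow 2 u).const_mul D).sub
      ((hasDerivAt_id u).const_mul (a * T))).add_const (a ^ 2)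
    refine HasDerivAt.congr_deriv (f := W T D a) h1 ?_
    push_cast
    ring
  have hquot := ((hasDerivAt_id y₀).mul ((hdW _).comp y₀ hd)).div (hd.mul (hdW y₀))
    (mul_ne_zero hP hW)
  have hev : deriv (leftMap T D a) =ᶠ[𝓝 y₀] fun u =>
      u * W T D a (leftMap T D a u) / (leftMap T D a u * W T D a u) := by
    filter_upwards [isOpen_interior.mem_nhds h] with u hu
    exact (hasDerivAt_leftMap hu).deriv
  refine (HasDerivAt.congr_of_eventuallyEq hquot hev).congr_deriv ?_
  simp only [Function.comp, id, Pi.mul_apply]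
  generalize leftMap T D a y₀ = p at *
  field_simp
  simp only [W]
  ring

end PoincareHalfMap

theorem proposition6 (T D a : ℝ) (hne : a ^ 2 + D ^ 2 ≠ 0) (y₀ : ℝ)
    (hy₀ : y₀ ∈ interior (PoincareHalfMap.leftDomain T D a)) :
    PoincareHalfMap.leftMap T D a y₀ ≠ 0 ∧
    PoincareHalfMap.W T D a y₀ ≠ 0 ∧
    HasDerivAt (PoincareHalfMap.leftMap T D a)
      (y₀ * PoincareHalfMap.W T D a (PoincareHalfMap.leftMap T D a y₀) /
        (PoincareHalfMap.leftMap T D a y₀ * PoincareHalfMap.W T D a y₀)) y₀ ∧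
    HasDerivAt (deriv (PoincareHalfMap.leftMap T D a))
      (-(a ^ 2 * (y₀ ^ 2 - PoincareHalfMap.leftMap T D a y₀ ^ 2) *
          PoincareHalfMap.W T D a (PoincareHalfMap.leftMap T D a y₀)) /
        (PoincareHalfMap.leftMap T D a y₀ ^ 3 * PoincareHalfMap.W T D a y₀ ^ 2)) y₀ :=
  ⟨(PoincareHalfMap.leftMap_neg hy₀).ne,
    PoincareHalfMap.W_ne_zero_of_flowReturn (PoincareHalfMap.pos_of_mem_interior hy₀)
      (PoincareHalfMap.flowReturn_of_mem_interior hy₀),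
    PoincareHalfMap.hasDerivAt_leftMap hy₀, PoincareHalfMap.hasDerivAt_deriv_leftMap hy₀⟩
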